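/- For integers $v,s,k,t\ge 0$ with $s,k\le v$, let $N_{sk}^{t}(v)$ be the real matrix whose rows and columns are indexed by the $s$-subsets and the $k$-subsets of a fixed $v$-element set, with entries $$N_{sk}^{t}(v)(S,K)=\binom{|S\cap K|-1}{t},$$ where $\binom{x}{m}=x(x-1)\cdots(x-m+1)/m!$ for every integer $x$ and every integer $m\ge 0$ (so $\binom{-1}{m}=(-1)^m$). By convention $\binom{v}{-1}=0$. Let $k\ge 1$ be an integer. (i) If $k\le v/2$, then the eigenvalues of $N_{kk}^{k-1}(v)$, counted with multiplicity, are $$\lambda_j=1-\binom{2k-v-1}{k-j}\quad\text{with multiplicity}\quad \binom{v}{j}-\binom{v}{j-1},\qquad j=0,1,\ldots,k-1,$$ together with $0$ with multiplicity $\binom{v}{k}-\binom{v}{k-1}$ (multiplicities being added when some of these values coincide). (ii) $\operatorname{rank} N_{kk}^{k-1}(2k)=\frac12\binom{2k}{k}$. (iii) If $k<v/2$, then $\operatorname{rank} N_{kk}^{k-1}(v)=\binom{v}{k-1}$. -/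

import Mathlib

/-- The `k`-subsets of the `v`-set `Fin v`. -/
abbrev KSubset (v k : ℕ) : Type := {S : Finset (Fin v) // S.card = k}

/-- The intersection matrix `N_{sk}^t(v)`: its rows and columns are indexed by the `s`-subsets and
the `k`-subsets of a `v`-set, and its `(S, K)` entry is the generalized binomial coefficient
`(|S ∩ K| - 1 choose t)`. The upper argument is an integer, which equals `-1` when `S` and `K` are
disjoint. -/
noncomputable def matrixN (s k t v : ℕ) : Matrix (KSubset v s) (KSubset v k) ℝ :=
  Matrix.of fun S K => ((Ring.choose (((S.1 ∩ K.1).card : ℤ) - 1) t : ℤ) : ℝ)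

/-- The value `λ_j = 1 - (2k - v - 1 choose k - j)`, with a generalized binomial coefficient whose
upper argument is an integer (negative when `2k ≤ v`). It is used for `j < k`. -/
noncomputable def eigenvalueN (k v j : ℕ) : ℝ :=
  1 - ((Ring.choose (2 * (k : ℤ) - (v : ℤ) - 1) (k - j) : ℤ) : ℝ)

/-- The number `(v choose j) - (v choose j - 1)`, where `(v choose -1) = 0`. It is used for
`2j ≤ v`, where the subtraction does not truncate. -/
def johnsonMultiplicity (v : ℕ) : ℕ → ℕ
  | 0 => v.choose 0
  | j + 1 => v.choose (j + 1) - v.choose j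

open Finset Polynomial

/-! Combinations of the (|S ∩ K| choose i) are treated with arbitrary coefficients `c`, which makes
induction on `k` possible. On (k+1)-subsets such a matrix is AB + c(k+1)·1 with A the inclusion
matrix, and BA is again of this kind on k-subsets. AB and BA share their characteristic polynomial
up to a power of X, so the whole spectrum follows (`charpoly_intersectionMatrix`).

Expanding (x-1 choose k-1) in the (x choose i) specializes this to N, and a finite-difference
identity evaluates the eigenvalues. N is symmetric, so its rank counts the nonzero ones: every λ_j
is nonzero when v > 2k, and when v = 2k all eigenvalues are 0 or 2, so the trace is twice the rank.
-/

/-- Summing over the `k`-subsets of a `(k + 1)`-set means deleting each of its points. -/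
theorem sum_subsets_eq_sum_erase {v k : ℕ} (S : KSubset v (k + 1)) (f : Finset (Fin v) → ℝ) :
    ∑ T : KSubset v k, (if T.1 ⊆ S.1 then f T.1 else 0) = ∑ s ∈ S.1, f (S.1.erase s) := by
  rw [← Finset.sum_subtype (univ.filter fun T : Finset (Fin v) => T.card = k) (by simp)
    (fun T => if T ⊆ S.1 then f T else 0), ← Finset.sum_filter]
  symm
  refine Finset.sum_nbij (fun s => S.1.erase s) ?_ ?_ ?_ (fun _ _ => rfl)
  · intro s hs
    simp [Finset.card_erase_of_mem hs, S.2, Finset.erase_subset]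
  · exact Finset.erase_injOn _
  · intro T hT
    simp only [coe_filter, mem_filter, mem_univ, true_and, Set.mem_ofPred_eq] at hT
    obtain ⟨a, ha, h⟩ := Finset.exists_eq_insert_iff.2 ⟨hT.2, by rw [hT.1, S.2]⟩
    refine ⟨a, ?_, ?_⟩
    · simp [← h]
    · simp [← h, ha]

/-- Summing over the `(k + 1)`-sets that contain a `k`-set means adding each point outside it. -/
theorem sum_supersets_eq_sum_insert {v k : ℕ} (T : KSubset v k) (f : Finset (Fin v) → ℝ) :
    ∑ K : KSubset v (k + 1), (if T.1 ⊆ K.1 then f K.1 else 0) =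
      ∑ u ∈ T.1ᶜ, f (insert u T.1) := by
  rw [← Finset.sum_subtype (univ.filter fun K : Finset (Fin v) => K.card = k + 1) (by simp)
    (fun K => if T.1 ⊆ K then f K else 0), ← Finset.sum_filter]
  symm
  refine Finset.sum_nbij (fun u => insert u T.1) ?_ ?_ ?_ (fun _ _ => rfl)
  · intro u hu
    simp [Finset.card_insert_of_notMem (mem_compl.1 hu), T.2]
  · intro a ha b hb h
    exact (Finset.insert_inj (mem_compl.1 ha)).1 h
  · intro K hK
    simp only [coe_filter, mem_filter, mem_univ, true_and, Set.mem_ofPred_eq] at hK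
    obtain ⟨a, ha, h⟩ := Finset.exists_eq_insert_iff.2 ⟨hK.2, by rw [hK.1, T.2]⟩
    exact ⟨a, by simpa using ha, h⟩

/-- Each i-subset of S ∩ K survives the deletion of exactly |S| - i points of S. -/
theorem sum_choose_card_erase_inter {α : Type*} [DecidableEq α] (S K : Finset α) (i : ℕ) :
    ∑ s ∈ S, (((S.erase s ∩ K).card.choose i : ℕ) : ℝ) =
      ((S.card : ℝ) - i) * ((S ∩ K).card.choose i : ℕ) := by
  have h1 : ∀ s ∈ S, (((S.erase s ∩ K).card.choose i : ℕ) : ℝ) =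
      if s ∈ K then ((((S ∩ K).card - 1).choose i : ℕ) : ℝ) else ((S ∩ K).card.choose i : ℕ) := by
    intro s hs
    rw [Finset.erase_inter]
    split_ifs with h
    · rw [Finset.card_erase_of_mem (mem_inter.2 ⟨hs, h⟩)]
    · rw [Finset.erase_eq_of_notMem (fun h' => h (mem_inter.1 h').2)]
  have h2 : (((S.filter (· ∉ K)).card : ℕ) : ℝ) = S.card - (S ∩ K).card := by
    rw [← Finset.card_filter_add_card_filter_not (s := S) (· ∈ K), Finset.filter_mem_eq_inter]
    push_cast
    ring
  rw [Finset.sum_congr rfl h1, Finset.sum_ite, Finset.sum_const, Finset.sum_const,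
    Finset.filter_mem_eq_inter, nsmul_eq_mul, nsmul_eq_mul, h2]
  rcases Nat.eq_zero_or_pos (S ∩ K).card with h0 | h0
  · rw [h0]
    cases i <;> simp
  · obtain ⟨x, hx⟩ : ∃ x, (S ∩ K).card = x + 1 := ⟨_, (Nat.succ_pred_eq_of_pos h0).symm⟩
    rw [hx, Nat.add_sub_cancel]
    cases i with
    | zero => simp
    | succ i =>
      have e1 : ((x + 1).choose (i + 1) : ℝ) = x.choose i + x.choose (i + 1) := by
        exact_mod_cast Nat.choose_succ_succ x i
      have e2 : ((x : ℝ) + 1) * x.choose i = (x + 1).choose (i + 1) * (i + 1) := by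
        exact_mod_cast Nat.add_one_mul_choose_eq x i
      push_cast
      linear_combination (-(x : ℝ) - 1) * e1 - e2

/-- By Pascal's rule, only the |T| - |S ∩ T| points u of S outside T add an extra term. Absorption
then removes |S ∩ T| from the weights, which keeps the class of matrices closed. -/
theorem sum_choose_card_inter_insert {α : Type*} [Fintype α] [DecidableEq α] (S T : Finset α)
    (hST : S.card = T.card) (i : ℕ) :
    ∑ u ∈ Tᶜ, (((S ∩ insert u T).card.choose (i + 1) : ℕ) : ℝ) =
      ((Fintype.card α : ℝ) - T.card - (i + 1)) * ((S ∩ T).card.choose (i + 1) : ℕ) +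
        ((T.card : ℝ) - i) * ((S ∩ T).card.choose i : ℕ) := by
  have h1 : ∀ u ∈ Tᶜ, (((S ∩ insert u T).card.choose (i + 1) : ℕ) : ℝ) =
      (S ∩ T).card.choose (i + 1) + if u ∈ S then (((S ∩ T).card.choose i : ℕ) : ℝ) else 0 := by
    intro u hu
    split_ifs with h
    · rw [Finset.inter_insert_of_mem h, Finset.card_insert_of_notMem
        (fun h' => mem_compl.1 hu (mem_inter.1 h').2), Nat.choose_succ_succ]
      push_cast
      ring
    · rw [Finset.inter_insert_of_notMem h, add_zero]
  have h2 : (((Tᶜ.filter (· ∈ S)).card : ℕ) : ℝ) = T.card - (S ∩ T).card := by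
    have : Tᶜ.filter (· ∈ S) = S \ T := by ext; simp [and_comm]
    rw [this, ← hST, ← Finset.card_sdiff_add_card_inter S T]
    push_cast
    ring
  rw [Finset.sum_congr rfl h1, Finset.sum_add_distrib, ← Finset.sum_filter, Finset.sum_const,
    Finset.sum_const, nsmul_eq_mul, nsmul_eq_mul, h2, Finset.card_compl,
    Nat.cast_sub (Finset.card_le_univ T)]
  have e : ((S ∩ T).card.choose (i + 1) : ℝ) * (i + 1) =
      (S ∩ T).card.choose i * ((S ∩ T).card - i) := by
    rcases le_or_gt i (S ∩ T).card with h | h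
    · have := Nat.choose_succ_right_eq (S ∩ T).card i
      rw [← Nat.cast_sub h]
      exact_mod_cast this
    · rw [Nat.choose_eq_zero_of_lt h, Nat.choose_eq_zero_of_lt (by omega)]
      simp
  linear_combination e

/-- The matrix on `k`-subsets whose entry at `(S, K)` is `∑ i ≤ k, c i * (|S ∩ K| choose i)`. -/
noncomputable def intersectionMatrix (v k : ℕ) (c : ℕ → ℝ) :
    Matrix (KSubset v k) (KSubset v k) ℝ :=
  Matrix.of fun S K => ∑ i ∈ range (k + 1), c i * ((S.1 ∩ K.1).card.choose i : ℕ)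

/-- The inclusion matrix of `k`-subsets in `(k + 1)`-subsets. -/
noncomputable def inclusionMatrix (v k : ℕ) : Matrix (KSubset v (k + 1)) (KSubset v k) ℝ :=
  Matrix.of fun S T => if T.1 ⊆ S.1 then 1 else 0

/-- The right factor of `intersectionMatrix v (k + 1) c - c (k + 1) • 1` by the inclusion matrix. -/
noncomputable def intersectionFactor (v k : ℕ) (c : ℕ → ℝ) :
    Matrix (KSubset v k) (KSubset v (k + 1)) ℝ :=
  Matrix.of fun T K =>
    ∑ i ∈ range (k + 1), c i / ((k : ℝ) + 1 - i) * ((T.1 ∩ K.1).card.choose i : ℕ)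

/-- The coefficients of the product of the two factors in the opposite order. -/
noncomputable def lowerCoeff (v k : ℕ) (c : ℕ → ℝ) (i : ℕ) : ℝ :=
  c i * ((v : ℝ) - k - i) / ((k : ℝ) + 1 - i) + if i < k then c (i + 1) else 0

theorem intersectionMatrix_succ (v k : ℕ) (c : ℕ → ℝ) :
    intersectionMatrix v (k + 1) c =
      inclusionMatrix v k * intersectionFactor v k c + c (k + 1) • 1 := by
  ext S K
  rw [Matrix.add_apply, Matrix.mul_apply, Matrix.smul_apply, intersectionMatrix, Matrix.of_apply,
    Finset.sum_range_succ]
  congr 1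
  · simp only [inclusionMatrix, intersectionFactor, Matrix.of_apply, ite_mul, one_mul, zero_mul]
    rw [sum_subsets_eq_sum_erase S
      (fun T => ∑ i ∈ range (k + 1), c i / ((k : ℝ) + 1 - i) * ((T ∩ K.1).card.choose i : ℕ)),
      Finset.sum_comm]
    refine Finset.sum_congr rfl fun i hi => ?_
    rw [← Finset.mul_sum, sum_choose_card_erase_inter, S.2]
    have : (k : ℝ) + 1 - i ≠ 0 := by
      have : (i : ℝ) < k + 1 := by exact_mod_cast mem_range.1 hi
      linarith
    push_cast
    field_simp
  -- The top term is the identity: two (k+1)-sets meet in k+1 points only if they are equal.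
  · rw [Matrix.one_apply, smul_eq_mul]
    congr 1
    have hS : (S.1 ∩ K.1).card ≤ k + 1 :=
      (Finset.card_le_card Finset.inter_subset_left).trans_eq S.2
    split_ifs with h
    · rw [h, Finset.inter_self, K.2, Nat.choose_self, Nat.cast_one]
    · rw [Nat.choose_eq_zero_of_lt, Nat.cast_zero]
      refine lt_of_le_of_ne hS fun h' => h (Subtype.ext ?_)
      have e1 := Finset.eq_of_subset_of_card_le (s := S.1 ∩ K.1) (t := S.1)
        Finset.inter_subset_left (by rw [h', S.2])
      have e2 := Finset.eq_of_subset_of_card_le (s := S.1 ∩ K.1) (t := K.1)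
        Finset.inter_subset_right (by rw [h', K.2])
      exact e1.symm.trans e2

theorem intersectionFactor_mul_inclusionMatrix (v k : ℕ) (c : ℕ → ℝ) :
    intersectionFactor v k c * inclusionMatrix v k =
      intersectionMatrix v k (lowerCoeff v k c) := by
  ext S T
  rw [Matrix.mul_apply]
  simp only [inclusionMatrix, intersectionFactor, intersectionMatrix, Matrix.of_apply, mul_ite,
    mul_one, mul_zero]
  rw [sum_supersets_eq_sum_insert T
      (fun K => ∑ i ∈ range (k + 1), c i / ((k : ℝ) + 1 - i) * ((S.1 ∩ K).card.choose i : ℕ)),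
      Finset.sum_comm]
  simp only [← Finset.mul_sum, lowerCoeff, add_mul, Finset.sum_add_distrib]
  have hlt : ∑ i ∈ range (k + 1), (if i < k then c (i + 1) else 0) *
      ((S.1 ∩ T.1).card.choose i : ℝ) =
      ∑ i ∈ range k, c (i + 1) * ((S.1 ∩ T.1).card.choose i : ℝ) := by
    rw [Finset.sum_range_succ, if_neg (lt_irrefl k), zero_mul, add_zero]
    exact Finset.sum_congr rfl fun i hi => by rw [if_pos (mem_range.1 hi)]
  -- Insertion turns degree i+1 into degrees i+1 and i; the shift pairs the latter with the c(i+1)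
  -- term of `lowerCoeff`.
  rw [hlt, Finset.sum_range_succ', Finset.sum_range_succ' _ k, add_right_comm,
    ← Finset.sum_add_distrib]
  congr 1
  · refine Finset.sum_congr rfl fun i hi => ?_
    rw [sum_choose_card_inter_insert _ _ (S.2.trans T.2.symm), T.2, Fintype.card_fin]
    have : (k : ℝ) - i ≠ 0 := by
      have : (i : ℝ) < k := by exact_mod_cast mem_range.1 hi
      linarith
    have e : (k : ℝ) + 1 - ((i + 1 : ℕ) : ℝ) = k - i := by push_cast; ring
    rw [e]
    push_cast
    field_simp
  · have hk : k ≤ v := by simpa [T.2] using Finset.card_le_univ T.1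
    simp [Finset.card_compl, T.2, Nat.cast_sub hk]
    ring

/-! ### Characteristic polynomial by induction on k -/

theorem charpoly_add_smul_one {n : Type*} [Fintype n] [DecidableEq n] (M : Matrix n n ℝ) (a : ℝ) :
    (M + a • 1).charpoly = M.charpoly.comp (X - C a) := by
  rw [Matrix.charpoly, Matrix.charpoly, ← Polynomial.coe_compRingHom_apply, RingHom.map_det]
  congr 1
  ext i j : 1
  by_cases h : i = j
  · subst h
    simp [Matrix.charmatrix_apply_eq]
    ring
  · simp [h]

/-- The eigenvalue of `intersectionMatrix v k c` on the `j`-th isotypic part of the functions on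
`k`-subsets. -/
noncomputable def intersectionEigenvalue (v k : ℕ) (c : ℕ → ℝ) (j : ℕ) : ℝ :=
  ∑ a ∈ range (k - j + 1),
    c (j + a) * (((k - j).choose a : ℕ) : ℝ) * (((v - 2 * j - a).choose (k - j - a) : ℕ) : ℝ)

theorem intersectionEigenvalue_self (v k : ℕ) (c : ℕ → ℝ) :
    intersectionEigenvalue v k c k = c k := by
  simp [intersectionEigenvalue]

/-- The coefficient of c(j+a+1) in the eigenvalue recursion, with n = v - 2j and m = k - j. -/
theorem choose_mul_choose_lower (n m a : ℕ) (ha : a < m) (hn : m ≤ n) :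
    (((m + 1).choose (a + 1) : ℕ) : ℝ) * ((n - (a + 1)).choose (m + 1 - (a + 1)) : ℕ) =
      ((n : ℝ) - m - (a + 1)) / (m - a) * (m.choose (a + 1) : ℕ) *
        ((n - (a + 1)).choose (m - (a + 1)) : ℕ) + (m.choose a : ℕ) * ((n - a).choose (m - a) : ℕ) := by
  obtain ⟨b, rfl⟩ : ∃ b, m = a + 1 + b := ⟨m - (a + 1), by omega⟩
  obtain ⟨N, rfl⟩ : ∃ N, n = a + 1 + N := ⟨n - (a + 1), by omega⟩
  have h1 : a + 1 + N - (a + 1) = N := by omega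
  have h2 : a + 1 + b + 1 - (a + 1) = b + 1 := by omega
  have h3 : a + 1 + b - (a + 1) = b := by omega
  have h4 : a + 1 + N - a = N + 1 := by omega
  have h5 : a + 1 + b - a = b + 1 := by omega
  rw [h1, h2, h3, h4, h5, Nat.choose_succ_succ N b, Nat.choose_succ_succ (a + 1 + b) a]
  have e1 : ((N.choose (b + 1) : ℕ) : ℝ) * (b + 1) = N.choose b * (N - b) := by
    have := Nat.choose_succ_right_eq N b
    rw [← Nat.cast_sub (by omega : b ≤ N)]
    exact_mod_cast this
  have e2 : (((a + 1 + b).choose (a + 1) : ℕ) : ℝ) * (a + 1) = (a + 1 + b).choose a * (b + 1) := by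
    have := Nat.choose_succ_right_eq (a + 1 + b) a
    rw [h5] at this
    exact_mod_cast this
  have h6 : ((a + 1 + b : ℕ) : ℝ) - a = b + 1 := by push_cast; ring
  have h7 : (b : ℝ) + 1 ≠ 0 := by positivity
  rw [h6]
  push_cast
  field_simp
  linear_combination (((a + 1 + b).choose (a + 1) : ℕ) : ℝ) * e1 + ((N.choose b : ℕ) : ℝ) * e2

theorem intersectionEigenvalue_succ (v k : ℕ) (c : ℕ → ℝ) (j : ℕ) (hj : j ≤ k)
    (hk : 2 * (k + 1) ≤ v) :
    intersectionEigenvalue v (k + 1) c j =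
      intersectionEigenvalue v k (lowerCoeff v k c) j + c (k + 1) := by
  obtain ⟨m, rfl⟩ : ∃ m, k = j + m := ⟨k - j, by omega⟩
  obtain ⟨n, rfl⟩ : ∃ n, v = 2 * j + n := ⟨v - 2 * j, by omega⟩
  have h1 : j + m - j = m := by omega
  have h2 : j + m + 1 - j = m + 1 := by omega
  have h3 : 2 * j + n - 2 * j = n := by omega
  simp only [intersectionEigenvalue, h1, h2, h3]
  rw [Finset.sum_range_succ _ (m + 1)]
  congr 1
  · simp only [lowerCoeff, add_mul, Finset.sum_add_distrib]
    have hlt : ∑ a ∈ range (m + 1), (if j + a < j + m then c (j + a + 1) else 0) *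
        ((m.choose a : ℕ) : ℝ) * ((n - a).choose (m - a) : ℕ) =
        ∑ a ∈ range m, c (j + (a + 1)) * ((m.choose a : ℕ) : ℝ) * ((n - a).choose (m - a) : ℕ) := by
      rw [Finset.sum_range_succ, if_neg (lt_irrefl _), zero_mul, zero_mul, add_zero]
      exact Finset.sum_congr rfl fun a ha => by
        rw [if_pos (by simpa using ha), add_assoc]
    rw [hlt, Finset.sum_range_succ', Finset.sum_range_succ' _ m, add_right_comm,
      ← Finset.sum_add_distrib]
    congr 1
    · refine Finset.sum_congr rfl fun a ha => ?_
      rw [mul_assoc, choose_mul_choose_lower n m a (mem_range.1 ha) (by omega)]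
      have e1 : ((2 * j + n : ℕ) : ℝ) - ((j + m : ℕ) : ℝ) - ((j + (a + 1) : ℕ) : ℝ) =
          n - m - (a + 1) := by push_cast; ring
      have e2 : ((j + m : ℕ) : ℝ) + 1 - ((j + (a + 1) : ℕ) : ℝ) = m - a := by push_cast; ring
      rw [e1, e2]
      ring
    · have e : ((n.choose (m + 1) : ℕ) : ℝ) * (m + 1) = n.choose m * (n - m) := by
        have := Nat.choose_succ_right_eq n m
        rw [← Nat.cast_sub (by omega : m ≤ n)]
        exact_mod_cast this
      have e1 : ((2 * j + n : ℕ) : ℝ) - ((j + m : ℕ) : ℝ) - ((j + 0 : ℕ) : ℝ) =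
          n - m := by push_cast; ring
      have e2 : ((j + m : ℕ) : ℝ) + 1 - ((j + 0 : ℕ) : ℝ) = m + 1 := by push_cast; ring
      have h7 : (m : ℝ) + 1 ≠ 0 := by positivity
      rw [e1, e2]
      simp only [Nat.choose_zero_right, Nat.sub_zero, add_zero, Nat.cast_one, mul_one]
      field_simp
      linear_combination c j * e
  · simp [add_assoc]

theorem card_kSubset (v k : ℕ) : Fintype.card (KSubset v k) = v.choose k := by
  simp

theorem charpoly_intersectionMatrix (v k : ℕ) (hk : 2 * k ≤ v) (c : ℕ → ℝ) :
    (intersectionMatrix v k c).charpoly =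
      ∏ j ∈ range (k + 1), (X - C (intersectionEigenvalue v k c j)) ^ johnsonMultiplicity v j := by
  induction k generalizing c with
  | zero =>
    have h : intersectionMatrix v 0 c = (0 : Matrix _ _ ℝ) + c 0 • 1 := by
      ext S K
      have : S = K := Subtype.ext (by rw [Finset.card_eq_zero.1 S.2, Finset.card_eq_zero.1 K.2])
      simp [intersectionMatrix, this]
    rw [h, charpoly_add_smul_one, Matrix.charpoly_zero, card_kSubset]
    simp [intersectionEigenvalue_self, johnsonMultiplicity]
  | succ k ih =>
    have hle : v.choose k ≤ v.choose (k + 1) :=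
      Nat.choose_le_succ_of_lt_half_left (by omega)
    -- Swapping the factors leaves X to the power (v choose k+1) - (v choose k), the multiplicity of
    -- the new eigenvalue c(k+1).
    rw [intersectionMatrix_succ, charpoly_add_smul_one, Matrix.charpoly_mul_comm_of_le _ _
      (by rwa [card_kSubset, card_kSubset]), intersectionFactor_mul_inclusionMatrix,
      ih (by omega), Finset.prod_range_succ _ (k + 1), intersectionEigenvalue_self,
      card_kSubset, card_kSubset, Polynomial.mul_comp, Polynomial.prod_comp, mul_comm]
    congr 1
    · refine Finset.prod_congr rfl fun j hj => ?_
      rw [intersectionEigenvalue_succ v k c j (Nat.lt_succ_iff.1 (mem_range.1 hj)) hk]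
      simp only [pow_comp, sub_comp, X_comp, C_comp, C_add]
      ring
    · simp [johnsonMultiplicity]

/-! ### Eigenvalues of N -/

/-- The m-th forward difference of x ↦ (x choose n-m), taken at x = n - m. -/
theorem alternating_sum_choose_mul_choose (m n : ℕ) (h : 2 * m ≤ n) :
    ∑ a ∈ range (m + 1), (-1 : ℤ) ^ a * (m.choose a : ℕ) * ((n - a).choose (m - a) : ℕ) =
      ((n - m).choose m : ℕ) := by
  have h1 := fwdDiff_iter_eq_sum_shift (h := 1)
    (fun x : ℕ => ((x.choose (m + (n - 2 * m)) : ℕ) : ℤ)) m (n - m)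
  rw [fwdDiff_iter_choose, ← Finset.sum_range_reflect] at h1
  have h2 : (n - m).choose (n - 2 * m) = (n - m).choose m := by
    rw [← Nat.choose_symm (by omega : m ≤ n - m)]
    congr 1
    omega
  simp only [h2] at h1
  rw [h1]
  refine Finset.sum_congr rfl fun a ha => ?_
  have ha' : a ≤ m := Nat.lt_succ_iff.1 (mem_range.1 ha)
  have e1 : m + 1 - 1 - a = m - a := by omega
  have e2 : m - (m - a) = a := by omega
  have e3 : n - m + (m - a) • 1 = n - a := by rw [smul_eq_mul]; omega
  have e4 : m + (n - 2 * m) = n - a - (m - a) := by omega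
  rw [e1, e2, e3, e4, Nat.choose_symm ha', Nat.choose_symm (by omega), smul_eq_mul]

/-- The coefficients of `(x - 1 choose k - 1)` in the basis of the `(x choose i)`. -/
noncomputable def shiftedChooseCoeff (k i : ℕ) : ℝ := if i < k then (-1) ^ (k + 1 + i) else 0

theorem sum_shiftedChooseCoeff_mul_choose (m x : ℕ) :
    ∑ i ∈ range (m + 1 + 1), shiftedChooseCoeff (m + 1) i * (x.choose i : ℕ) =
      ((Ring.choose ((x : ℤ) - 1) m : ℤ) : ℝ) := by
  have h : ∑ i ∈ range (m + 1 + 1), shiftedChooseCoeff (m + 1) i * (x.choose i : ℕ) =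
      (((-1) ^ m * ∑ i ∈ range (m + 1), (-1) ^ i * (x.choose i : ℤ) : ℤ) : ℝ) := by
    rw [Finset.sum_range_succ, shiftedChooseCoeff, if_neg (lt_irrefl _), zero_mul, add_zero]
    push_cast
    rw [Finset.mul_sum]
    refine Finset.sum_congr rfl fun i hi => ?_
    rw [shiftedChooseCoeff, if_pos (mem_range.1 hi)]
    ring
  rw [h]
  congr 1
  -- At x = 0 the upper argument is -1 and only the term i = 0 survives.
  cases x with
  | zero =>
    rw [Finset.sum_range_succ']
    simp [Ring.choose_neg', Units.smul_def, Int.negOnePow_def]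
  | succ n =>
    rw [Int.alternating_sum_range_choose_eq_choose, ← mul_assoc, ← mul_pow]
    simp [Ring.choose_natCast]

theorem matrixN_eq_intersectionMatrix (v k : ℕ) (hk : 1 ≤ k) :
    matrixN k k (k - 1) v = intersectionMatrix v k (shiftedChooseCoeff k) := by
  obtain ⟨m, rfl⟩ : ∃ m, k = m + 1 := ⟨k - 1, by omega⟩
  ext S K
  simp only [matrixN, intersectionMatrix, Matrix.of_apply, sum_shiftedChooseCoeff_mul_choose,
    Nat.add_sub_cancel]

theorem eigenvalueN_eq (v k j : ℕ) (hj : j < k) (hk : 2 * k ≤ v) :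
    eigenvalueN k v j = 1 - (-1) ^ (k - j) * ((v - k - j).choose (k - j) : ℕ) := by
  have h : (2 * (k : ℤ) - v - 1) = -((v + 1 - 2 * k : ℕ) : ℤ) := by omega
  have h' : ((v + 1 - 2 * k : ℕ) : ℤ) + ((k - j : ℕ) : ℤ) - 1 = ((v - k - j : ℕ) : ℤ) := by omega
  rw [eigenvalueN, h, Ring.choose_neg, h', Ring.choose_natCast]
  simp [Units.smul_def, Int.negOnePow_def]

/-- Since the k-th coefficient vanishes, the alternating sum lacks its last term a = m; this
accounts for the 1 in λ_j. -/
theorem intersectionEigenvalue_shiftedChooseCoeff (v k j : ℕ) (hj : j < k) (hk : 2 * k ≤ v) :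
    intersectionEigenvalue v k (shiftedChooseCoeff k) j = eigenvalueN k v j := by
  obtain ⟨m, rfl⟩ : ∃ m, k = j + m := ⟨k - j, by omega⟩
  have h := alternating_sum_choose_mul_choose m (v - 2 * j) (by omega)
  have e1 : v - 2 * j - m = v - (j + m) - j := by omega
  rw [e1, Finset.sum_range_succ] at h
  rw [eigenvalueN_eq _ _ _ hj hk, intersectionEigenvalue, Nat.add_sub_cancel_left,
    Finset.sum_range_succ, shiftedChooseCoeff, if_neg (lt_irrefl _)]
  have h2 : ((v - (j + m) - j).choose m : ℝ) = _ := congrArg (Int.cast (R := ℝ)) h.symm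
  rw [h2]
  have h3 : ∑ a ∈ range m, shiftedChooseCoeff (j + m) (j + a) * ((m.choose a : ℕ) : ℝ) *
      (((v - 2 * j - a).choose (m - a) : ℕ) : ℝ) = (-1) ^ (m + 1) *
      ∑ a ∈ range m, (-1 : ℝ) ^ a * ((m.choose a : ℕ) : ℝ) *
      (((v - 2 * j - a).choose (m - a) : ℕ) : ℝ) := by
    rw [Finset.mul_sum]
    refine Finset.sum_congr rfl fun a ha => ?_
    rw [shiftedChooseCoeff, if_pos (by simpa using ha)]
    have : (-1 : ℝ) ^ (j + m + 1 + (j + a)) = (-1) ^ (m + 1) * (-1) ^ a := by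
      rw [show j + m + 1 + (j + a) = 2 * j + ((m + 1) + a) by ring, pow_add, pow_mul, pow_add]
      simp
    rw [this]
    ring
  rw [h3]
  have h4 : (-1 : ℝ) ^ m * (-1) ^ m = 1 := by rw [← mul_pow]; simp
  push_cast
  simp only [Nat.choose_self, Nat.sub_self, Nat.choose_zero_right, Nat.cast_one, mul_one,
    add_zero]
  linear_combination h4

theorem roots_charpoly_matrixN (v k : ℕ) (hk : 1 ≤ k) (hv : 2 * k ≤ v) :
    (matrixN k k (k - 1) v).charpoly.roots =
      (∑ j ∈ range k, Multiset.replicate (johnsonMultiplicity v j) (eigenvalueN k v j)) +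
        Multiset.replicate (v.choose k - v.choose (k - 1)) (0 : ℝ) := by
  rw [matrixN_eq_intersectionMatrix v k hk, charpoly_intersectionMatrix v k hv,
    Polynomial.roots_prod _ _ (Finset.prod_ne_zero_iff.2 fun j _ =>
      pow_ne_zero _ (Polynomial.X_sub_C_ne_zero _))]
  simp only [Polynomial.roots_pow, Polynomial.roots_X_sub_C, Multiset.nsmul_singleton]
  change ∑ j ∈ range (k + 1), Multiset.replicate (johnsonMultiplicity v j)
    (intersectionEigenvalue v k (shiftedChooseCoeff k) j) = _
  rw [Finset.sum_range_succ, intersectionEigenvalue_self, shiftedChooseCoeff,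
    if_neg (lt_irrefl k)]
  congr 1
  · exact Finset.sum_congr rfl fun j hj => by
      rw [intersectionEigenvalue_shiftedChooseCoeff v k j (mem_range.1 hj) hv]
  · obtain ⟨m, rfl⟩ : ∃ m, k = m + 1 := ⟨k - 1, by omega⟩
    rfl

/-! ### Ranks -/

theorem matrixN_isHermitian (v k t : ℕ) : (matrixN k k t v).IsHermitian := by
  ext S K
  simp [matrixN, Finset.inter_comm]

theorem rank_eq_countP_roots {n : Type*} [Fintype n] [DecidableEq n] {A : Matrix n n ℝ}
    (hA : A.IsHermitian) : A.rank = A.charpoly.roots.countP (· ≠ 0) := by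
  rw [hA.rank_eq_card_non_zero_eigs, hA.roots_charpoly_eq_eigenvalues, Multiset.countP_map,
    Fintype.card_subtype]
  rfl

theorem sum_johnsonMultiplicity (v k : ℕ) (hk : 2 * k ≤ v) :
    ∑ j ∈ range (k + 1), johnsonMultiplicity v j = v.choose k := by
  induction k with
  | zero => simp [johnsonMultiplicity]
  | succ k ih =>
    have hle : v.choose k ≤ v.choose (k + 1) :=
      Nat.choose_le_succ_of_lt_half_left (by omega)
    rw [Finset.sum_range_succ, ih (by omega), johnsonMultiplicity]
    omega

theorem rank_matrixN_of_lt (v k : ℕ) (hk : 1 ≤ k) (hv : 2 * k < v) :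
    (matrixN k k (k - 1) v).rank = v.choose (k - 1) := by
  have h : ∀ j ∈ range k, eigenvalueN k v j ≠ 0 := by
    intro j hj
    have hj' := mem_range.1 hj
    rw [eigenvalueN_eq v k j hj' hv.le]
    -- Here v > 2k is essential: at v = 2k this binomial is 1 and λ_j can vanish.
    have h2 : 1 < (v - k - j).choose (k - j) := by
      calc 1 < k - j + 1 := by omega
        _ = (k - j + 1).choose (k - j) := by rw [Nat.choose_succ_self_right]
        _ ≤ _ := Nat.choose_le_choose _ (by omega)
    have h3 : (1 : ℝ) < ((v - k - j).choose (k - j) : ℕ) := by exact_mod_cast h2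
    rcases neg_one_pow_eq_or ℝ (k - j) with h | h <;> rw [h] <;> intro h' <;> linarith
  rw [rank_eq_countP_roots (matrixN_isHermitian v k (k - 1)), roots_charpoly_matrixN v k hk hv.le,
    Multiset.countP_add, ← sum_johnsonMultiplicity v (k - 1) (by omega), Nat.sub_add_cancel hk,
    ← Multiset.coe_countPAddMonoidHom, map_sum]
  have h0 : ∀ n : ℕ, (Multiset.replicate n (0 : ℝ)).countP (· ≠ 0) = 0 := fun n =>
    Multiset.countP_eq_zero.2 fun x hx => by simp [Multiset.eq_of_mem_replicate hx]
  simp only [Multiset.coe_countPAddMonoidHom]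
  rw [h0, add_zero]
  refine Finset.sum_congr rfl fun j hj => ?_
  have h1 := (Multiset.countP_eq_card (p := fun x : ℝ => x ≠ 0)
    (s := Multiset.replicate (johnsonMultiplicity v j) (eigenvalueN k v j))).2 fun x hx =>
      (Multiset.eq_of_mem_replicate hx).symm ▸ h j hj
  rw [h1, Multiset.card_replicate]

theorem matrixN_apply_self (v k : ℕ) (hk : 1 ≤ k) (S : KSubset v k) :
    matrixN k k (k - 1) v S S = 1 := by
  have : ((S.1.card : ℤ) - 1) = ((k - 1 : ℕ) : ℤ) := by rw [S.2]; omega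
  simp only [matrixN, Matrix.of_apply, Finset.inter_self, this, Ring.choose_natCast]
  simp

theorem Multiset.sum_eq_mul_countP_ne_zero (s : Multiset ℝ) (a : ℝ) (h : ∀ x ∈ s, x = 0 ∨ x = a) :
    s.sum = a * s.countP (· ≠ 0) := by
  induction s using Multiset.induction_on with
  | empty => simp
  | cons x s ih =>
    rw [Multiset.sum_cons, ih fun y hy => h y (Multiset.mem_cons_of_mem hy)]
    by_cases hx : x = 0
    · rw [Multiset.countP_cons_of_neg (p := fun y : ℝ => y ≠ 0) _ (by simpa using hx), hx, zero_add]
    · rw [Multiset.countP_cons_of_pos (p := fun y : ℝ => y ≠ 0) _ hx, (h x (Multiset.mem_cons_self x s)).resolve_left hx]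
      push_cast
      ring

theorem rank_matrixN_two_mul (k : ℕ) (hk : 1 ≤ k) :
    ((matrixN k k (k - 1) (2 * k)).rank : ℝ) = 1 / 2 * ((2 * k).choose k : ℝ) := by
  have hA := matrixN_isHermitian (2 * k) k (k - 1)
  have htr : (matrixN k k (k - 1) (2 * k)).trace = ((2 * k).choose k : ℕ) := by
    simp [Matrix.trace, matrixN_apply_self _ k hk]
  -- The trace is (2k choose k), as the diagonal is 1, and also 2 · rank, as λ_j = 1 - (-1)^(k-j) is
  -- 0 or 2.
  rw [Matrix.trace_eq_sum_roots_charpoly_of_splits hA.splits_charpoly,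
    Multiset.sum_eq_mul_countP_ne_zero _ 2, ← rank_eq_countP_roots hA] at htr
  · linarith
  intro x hx
  rw [roots_charpoly_matrixN _ k hk le_rfl, Multiset.mem_add, Multiset.mem_sum] at hx
  rcases hx with ⟨j, hj, hx⟩ | hx
  · have hj' := mem_range.1 hj
    rw [Multiset.eq_of_mem_replicate hx, eigenvalueN_eq _ k j hj' le_rfl,
      show 2 * k - k - j = k - j by omega, Nat.choose_self]
    rcases neg_one_pow_eq_or ℝ (k - j) with h | h <;> rw [h] <;> norm_num
  · exact Or.inl (Multiset.eq_of_mem_replicate hx)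

theorem mainTheorem3 (k : ℕ) (hk : 1 ≤ k) :
    (∀ v : ℕ, 2 * k ≤ v →
      (matrixN k k (k - 1) v).charpoly.roots =
        (∑ j ∈ Finset.range k, Multiset.replicate (johnsonMultiplicity v j) (eigenvalueN k v j)) +
          Multiset.replicate (v.choose k - v.choose (k - 1)) (0 : ℝ)) ∧
    (((matrixN k k (k - 1) (2 * k)).rank : ℝ) = 1 / 2 * ((2 * k).choose k : ℝ)) ∧
    (∀ v : ℕ, 2 * k < v → (matrixN k k (k - 1) v).rank = v.choose (k - 1)) :=
  ⟨fun v hv => roots_charpoly_matrixN v k hk hv, rank_matrixN_two_mul k hk,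
    fun v hv => rank_matrixN_of_lt v k hk hv⟩
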